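/- **Setting.** Let $N,\hat N\ge 0$ be integers, $\sigma\ge 0$, $a\in\mathbb R$, $a_1,\dots,a_N>0$, $\hat a_1,\dots,\hat a_{\hat N}>0$, $0<\rho_1<\dots<\rho_N$ and $0<\hat\rho_1<\dots<\hat\rho_{\hat N}$. Let $X=(X_t)_{t\ge 0}$ be a hyperexponential Lévy process with these parameters, i.e. a real Lévy process with $X_0=0$ almost surely and $$\mathbb E\big[e^{i\theta X_t}\big]=\exp\Big(t\Big(ia\theta-\tfrac{\sigma^2\theta^2}{2}+\int_{\mathbb R}(e^{i\theta x}-1)\,\nu(dx)\Big)\Big),\qquad t\ge 0,\ \theta\in\mathbb R,$$ where $$\nu(dx)=\mathbb I(x<0)\sum_{\ell=1}^{\hat N}\hat a_\ell\hat\rho_\ell e^{\hat\rho_\ell x}\,dx+\mathbb I(x>0)\sum_{\ell=1}^{N}a_\ell\rho_\ell e^{-\rho_\ell x}\,dx .$$ Its Laplace exponent is, as a rational function, $$\psi(z)=\frac{\sigma^2z^2}{2}+az+z\sum_{\ell=1}^{N}\frac{a_\ell}{\rho_\ell-z}-z\sum_{\ell=1}^{\hat N}\frac{\hat a_\ell}{\hat\rho_\ell+z}.$$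 Let $q>0$ and let $\mathbf e(q)$ be an exponential random variable with mean $q^{-1}$, independent of $X$. Put $M=N+1$ if $\sigma\ne 0$ or $a>0$, and $M=N$ otherwise; put $\hat M=\hat N+1$ if $\sigma\ne 0$ or $a<0$, and $\hat M=\hat N$ otherwise. **Theorem 3.1.** The equation $\psi(z)=q$ has exactly $M$ positive solutions $\zeta_1<\dots<\zeta_M$ and exactly $\hat M$ negative solutions $-\hat\zeta_1>\dots>-\hat\zeta_{\hat M}$. They satisfy $\psi'(\zeta_\ell)>0$ and $\psi'(-\hat\zeta_\ell)<0$, and $X_{\mathbf e(q)}$ has the distribution $$\mathbb P\big(X_{\mathbf e(q)}\in dx\big)=q\alpha\,\delta_0(dx)+q\left(\mathbb I(x>0)\sum_{\ell=1}^{M}\frac{e^{-\zeta_\ell x}}{\psi'(\zeta_\ell)}-\mathbb I(x<0)\sum_{\ell=1}^{\hat M}\frac{e^{\hat\zeta_\ell x}}{\psi'(-\hat\zeta_\ell)}\right)dx,$$ where $\alpha=\gamma:=\big(q+\sum_{\ell=1}^{N}a_\ell+\sum_{\ell=1}^{\hat N}\hat a_\ell\big)^{-1}$ if $\sigma^2$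 and $a$ are both zero, and $\alpha=0$ otherwise. -/

import Mathlib

open MeasureTheory ProbabilityTheory Filter Topology
open scoped NNReal ENNReal

noncomputable section

/-- `X` is a (one-dimensional, real-valued) Lévy process on the probability space `(Ω, P)`: it starts
at `0` almost surely, has independent and stationary increments, and has almost surely
right-continuous paths with left limits. -/
structure IsLevyProcess {Ω : Type*} [MeasurableSpace Ω] (P : Measure Ω) (X : ℝ≥0 → Ω → ℝ) :
    Prop where
  measurable : ∀ t, Measurable (X t)
  zero : ∀ᵐ ω ∂P, X 0 ω = 0
  indep : HasIndepIncrements X P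
  stationary : ∀ s h : ℝ≥0, IdentDistrib (fun ω => X (s + h) ω - X s ω) (X h) P P
  cadlag : ∀ᵐ ω ∂P, ∀ t : ℝ≥0,
    ContinuousWithinAt (fun s => X s ω) (Set.Ici t) t ∧
      ∃ l : ℝ, Tendsto (fun s => X s ω) (𝓝[<] t) (𝓝 l)

/-- Parameters of a hyperexponential Lévy process: the Gaussian coefficient `σ ≥ 0`, the drift, the
`N` weights and rates `a, ρ` of the positive jumps and the `N'` weights and rates `aHat, ρHat` of
the negative jumps. Either of `N`, `N'` may be zero. -/
structure HyperexpParams (N N' : ℕ) where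
  σ : ℝ
  drift : ℝ
  a : Fin N → ℝ
  ρ : Fin N → ℝ
  aHat : Fin N' → ℝ
  ρHat : Fin N' → ℝ
  σ_nonneg : 0 ≤ σ
  a_pos : ∀ l, 0 < a l
  ρ_pos : ∀ l, 0 < ρ l
  ρ_strictMono : StrictMono ρ
  aHat_pos : ∀ l, 0 < aHat l
  ρHat_pos : ∀ l, 0 < ρHat l
  ρHat_strictMono : StrictMono ρHat

namespace HyperexpParams

variable {N N' : ℕ} (p : HyperexpParams N N')

/-- The Lévy density
`𝟙(x < 0) ∑ aHat_l ρHat_l e^{ρHat_l x} + 𝟙(x > 0) ∑ a_l ρ_l e^{-ρ_l x}`. -/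
def levyDensity (x : ℝ) : ℝ :=
  (if x < 0 then ∑ l, p.aHat l * p.ρHat l * Real.exp (p.ρHat l * x) else 0) +
    (if 0 < x then ∑ l, p.a l * p.ρ l * Real.exp (-(p.ρ l) * x) else 0)

/-- The (finite) Lévy measure `ν`. -/
def levyMeasure : Measure ℝ :=
  volume.withDensity fun x => ENNReal.ofReal (p.levyDensity x)

/-- The Lévy–Khintchine exponent `θ ↦ i a θ - σ² θ² / 2 + ∫ (e^{iθx} - 1) ν(dx)` of the process with
drift `a`, Gaussian coefficient `σ` and Lévy measure `ν`. As `ν` is finite, no truncation function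
is needed. -/
def levyKhintchine (θ : ℝ) : ℂ :=
  Complex.I * p.drift * θ - (p.σ : ℂ) ^ 2 * (θ : ℂ) ^ 2 / 2 +
    ∫ x : ℝ, (Complex.exp (Complex.I * θ * x) - 1) ∂p.levyMeasure

/-- The Laplace exponent, extended to the real line as the rational function
`ψ(z) = σ² z² / 2 + a z + z ∑ a_l / (ρ_l - z) - z ∑ aHat_l / (ρHat_l + z)`.
It has poles at the points `ρ_l` and `-ρHat_l`, where the value of this Lean function carries no
meaning. -/
def psi (z : ℝ) : ℝ :=
  p.σ ^ 2 * z ^ 2 / 2 + p.drift * z + z * ∑ l, p.a l / (p.ρ l - z) -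
    z * ∑ l, p.aHat l / (p.ρHat l + z)

/-- The real solutions of `ψ(z) = q` (the poles of `ψ` are not solutions). -/
def solutions (q : ℝ) : Set ℝ :=
  {z | (∀ l, z ≠ p.ρ l) ∧ (∀ l, z ≠ -p.ρHat l) ∧ p.psi z = q}

open Classical in
/-- The number `M` of positive solutions of `ψ(z) = q`: it is `N + 1` if `σ ≠ 0` or `a > 0`, and `N`
otherwise. -/
def numPos : ℕ := if p.σ ≠ 0 ∨ 0 < p.drift then N + 1 else N

open Classical in
/-- The number of negative solutions of `ψ(z) = q`: it is `N' + 1` if `σ ≠ 0` or `a < 0`, and `N'`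
otherwise. -/
def numNeg : ℕ := if p.σ ≠ 0 ∨ p.drift < 0 then N' + 1 else N'

/-- `γ = 1 / (q + ∑ a_l + ∑ aHat_l)`. -/
def gam (q : ℝ) : ℝ := 1 / (q + ∑ l, p.a l + ∑ l, p.aHat l)

open Classical in
/-- `α = γ` if `σ² = 0` and `a = 0`, and `α = 0` otherwise. -/
def alpha (q : ℝ) : ℝ := if p.σ ^ 2 = 0 ∧ p.drift = 0 then p.gam q else 0

/-- The density of the absolutely continuous part, built from numbers `ζ_l` and `ζHat_l`:
`q (𝟙(x > 0) ∑ e^{-ζ_l x} / ψ'(ζ_l) - 𝟙(x < 0) ∑ e^{ζHat_l x} / ψ'(-ζHat_l))`. -/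
def killedDensity {M M' : ℕ} (q : ℝ) (ζ : Fin M → ℝ) (ζHat : Fin M' → ℝ) (x : ℝ) : ℝ :=
  q * ((if 0 < x then ∑ l, Real.exp (-(ζ l) * x) / deriv p.psi (ζ l) else 0) -
    (if x < 0 then ∑ l, Real.exp (ζHat l * x) / deriv p.psi (-(ζHat l)) else 0))

end HyperexpParams

/-- `X` is a hyperexponential Lévy process with parameters `p`: a Lévy process whose
Lévy–Khintchine triplet is given by the drift, the Gaussian coefficient and the Lévy measure of `p`,
that is `E[e^{iθX_t}] = e^{t (i a θ - σ² θ² / 2 + ∫ (e^{iθx} - 1) ν(dx))}`. -/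
structure IsHyperexponential {Ω : Type*} [MeasurableSpace Ω] (P : Measure Ω) (X : ℝ≥0 → Ω → ℝ)
    {N N' : ℕ} (p : HyperexpParams N N') : Prop extends IsLevyProcess P X where
  charFun_eq : ∀ (t : ℝ≥0) (θ : ℝ),
    charFun (P.map (X t)) θ = Complex.exp ((t : ℝ) * p.levyKhintchine θ)

end

/-!
The function `z ↦ (ψ(z) - q) / z` is a Pick function: it is `σ² z / 2 + a` minus simple fractions
with positive weights `q, a_l, aHat_l` at the poles `0, ρ_l, -ρHat_l`. It therefore increases
strictly on each interval between consecutive poles and vanishes there exactly once; on an unbounded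
interval the sign at infinity decides whether it vanishes. At a zero `z` of this function `ψ'(z)` is
`z` times its positive derivative.

With `Ψ` the Lévy–Khintchine exponent, `X` at the exponential time has characteristic function
`q / (q - Ψ(θ))`, and `Ψ(θ) = ψ(iθ)` as rational functions. The zeros just found exhaust the degree
of the numerator of `q - ψ`, so `1 / (q - ψ)` has only simple poles, all of them real, and the terms
of its partial fraction expansion are the characteristic functions of exponential densities on the
two half-lines. The constant term `α` is the atom at the origin.

Joint measurability of `X` is avoided by approximating the random time from the right by its values
rounded up to the grids `ℕ / n` and using right-continuity of the paths.
-/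

noncomputable section

section PickFun

/-- The rational function `s z + b - ∑ c_k / (z - x_k)`. For `0 ≤ s` and `0 < c_k` it is a Pick
function (it maps the upper half-plane to itself); `(ψ(z) - q) / z` is of this form. At a pole `x_k`
the value carries no meaning. -/
def pickFun {F K : Type*} [Field F] [Fintype K] (s b : F) (c x : K → F) (z : F) : F :=
  s * z + b - ∑ k, c k / (z - x k)

/-- The derivative `s + ∑ c_k / (z - x_k)²` of `pickFun s b c x`, as a rational function. -/
def pickFunDeriv {F K : Type*} [Field F] [Fintype K] (s : F) (c x : K → F) (z : F) : F :=
  s + ∑ k, c k / (z - x k) ^ 2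

theorem hasDerivAt_pickFun {𝕜 K : Type*} [NontriviallyNormedField 𝕜] [Fintype K] (s b : 𝕜)
    (c : K → 𝕜) {x : K → 𝕜} {z : 𝕜} (hz : ∀ k, z ≠ x k) :
    HasDerivAt (pickFun s b c x) (pickFunDeriv s c x z) z := by
  have hpole (k : K) : HasDerivAt (fun z => c k / (z - x k)) (-(c k / (z - x k) ^ 2)) z :=
    ((hasDerivAt_const z (c k)).div ((hasDerivAt_id z).sub_const (x k))
      (sub_ne_zero.2 (hz k))).congr_deriv (by simp [neg_div])
  have h := (((hasDerivAt_id z).const_mul s).add_const b).sub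
    (HasDerivAt.fun_sum fun k (_ : k ∈ Finset.univ) => hpole k)
  exact h.congr_deriv (by simp [pickFunDeriv])

variable {K : Type*} [Fintype K] {s b : ℝ} {c x : K → ℝ}

theorem pickFunDeriv_pos [Nonempty K] (hs : 0 ≤ s) (hc : ∀ k, 0 < c k) {z : ℝ}
    (hz : ∀ k, z ≠ x k) : 0 < pickFunDeriv s c x z :=
  add_pos_of_nonneg_of_pos hs <| Finset.sum_pos
    (fun k _ => div_pos (hc k) (sq_pos_of_ne_zero (sub_ne_zero.2 (hz k)))) Finset.univ_nonempty

theorem continuousOn_pickFun {S : Set ℝ} (hS : ∀ z ∈ S, ∀ k, z ≠ x k) :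
    ContinuousOn (pickFun s b c x) S :=
  fun z hz => (hasDerivAt_pickFun s b c (hS z hz)).continuousAt.continuousWithinAt

theorem strictMonoOn_pickFun [Nonempty K] (hs : 0 ≤ s) (hc : ∀ k, 0 < c k) {S : Set ℝ}
    (hconv : Convex ℝ S) (hS : ∀ z ∈ S, ∀ k, z ≠ x k) : StrictMonoOn (pickFun s b c x) S := by
  refine strictMonoOn_of_deriv_pos hconv (continuousOn_pickFun hS) fun z hz => ?_
  have hz' := hS z (interior_subset hz)
  rw [(hasDerivAt_pickFun s b c hz').deriv]
  exact pickFunDeriv_pos hs hc hz'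

theorem pickFun_neg (s b : ℝ) (c x : K → ℝ) (z : ℝ) :
    pickFun s b c x (-z) = -pickFun s (-b) c (-x) z := by
  have hterm (k : K) : c k / (-z - x k) = -(c k / (z - (-x) k)) := by
    rw [← div_neg, Pi.neg_apply]
    ring
  simp only [pickFun, hterm, Finset.sum_neg_distrib]
  ring

theorem tendsto_pickFun_nhdsGT (hc : ∀ k, 0 < c k) (hx : Function.Injective x) (k : K) :
    Tendsto (pickFun s b c x) (𝓝[>] x k) atBot := by
  classical
  have hsing : Tendsto (fun z => c k / (z - x k)) (𝓝[>] x k) atTop := by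
    have hsub : Tendsto (fun z => z - x k) (𝓝[>] x k) (𝓝[>] 0) := by
      simpa using (Filter.tendsto_map (f := fun z => z - x k) (x := 𝓝[>] x k))
    simpa only [div_eq_mul_inv, Function.comp_apply] using
      (tendsto_inv_nhdsGT_zero.comp hsub).const_mul_atTop (hc k)
  have hreg : ContinuousAt
      (fun z => s * z + b - ∑ j ∈ Finset.univ.erase k, c j / (z - x j)) (x k) := by
    refine .sub (by fun_prop) (tendsto_finsetSum _ fun j hj => ?_)
    exact ContinuousAt.div (by fun_prop) (by fun_prop)
      (sub_ne_zero.2 fun h => Finset.ne_of_mem_erase hj (hx h).symm)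
  refine ((tendsto_neg_atTop_atBot.comp hsing).atBot_add
    (hreg.tendsto.mono_left nhdsWithin_le_nhds)).congr fun z => ?_
  rw [pickFun, ← Finset.add_sum_erase _ _ (Finset.mem_univ k), Function.comp_apply]
  ring

theorem tendsto_pickFun_nhdsLT (hc : ∀ k, 0 < c k) (hx : Function.Injective x) (k : K) :
    Tendsto (pickFun s b c x) (𝓝[<] x k) atTop := by
  have h := tendsto_pickFun_nhdsGT (s := s) (b := -b) hc (neg_injective.comp hx) k
  refine (tendsto_neg_atBot_atTop.comp (h.comp tendsto_neg_nhdsLT)).congr fun z => ?_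
  rw [← neg_neg z, pickFun_neg]
  simp only [Function.comp_apply, neg_neg]
  rfl

theorem eventually_pickFun_pos (hs : 0 ≤ s) (h : s ≠ 0 ∨ 0 < b) :
    ∀ᶠ z in atTop, 0 < pickFun s b c x z := by
  have hsum : Tendsto (fun z => ∑ k, c k / (z - x k)) atTop (𝓝 0) := by
    simpa [← sub_eq_add_neg] using tendsto_finsetSum Finset.univ fun k _ =>
      (tendsto_const_nhds (x := c k)).div_atTop
        (tendsto_atTop_add_const_right atTop (-x k) tendsto_id)
  rcases hs.eq_or_lt with rfl | hs
  · have hb : 0 < b := by simpa using h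
    filter_upwards [hsum.eventually_lt_const hb] with z hz
    simpa [pickFun] using hz
  · filter_upwards [hsum.eventually_lt_const one_pos,
      (tendsto_id.const_mul_atTop hs).eventually_gt_atTop (1 - b)] with z hz hlin
    simp only [pickFun, id] at hlin ⊢
    linarith

theorem pickFun_neg_of_forall_lt [Nonempty K] (hs : s = 0) (hb : b ≤ 0) (hc : ∀ k, 0 < c k)
    {z : ℝ} (hz : ∀ k, x k < z) : pickFun s b c x z < 0 := by
  have : 0 < ∑ k, c k / (z - x k) :=
    Finset.sum_pos (fun k _ => div_pos (hc k) (sub_pos.2 (hz k))) Finset.univ_nonempty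
  simp only [pickFun, hs]
  linarith

end PickFun

section Gap

variable {K : Type*} {x : K → ℝ} {j k : K} {y z : ℝ}

/-- The open interval from `x k` to the next larger value of `x`, or to `∞` if there is none. -/
def gap (x : K → ℝ) (k : K) : Set ℝ :=
  {z | x k < z ∧ ∀ j, x k < x j → z < x j}

theorem ne_of_mem_gap (hz : z ∈ gap x k) (j : K) : z ≠ x j := by
  rintro rfl
  exact lt_irrefl _ (hz.2 j hz.1)

theorem lt_of_mem_gap_of_lt (hy : y ∈ gap x j) (hz : z ∈ gap x k) (hjk : x j < x k) : y < z :=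
  (hy.2 k hjk).trans hz.1

theorem convex_gap (x : K → ℝ) (k : K) : Convex ℝ (gap x k) :=
  Set.OrdConnected.convex ⟨fun _ hy _ hz _ hw =>
    ⟨hy.1.trans_le hw.1, fun j hj => hw.2.trans_lt (hz.2 j hj)⟩⟩

section Finite

variable [Finite K]

theorem exists_mem_gap (hk : x k < z) (hz : ∀ j, z ≠ x j) : ∃ j, x k ≤ x j ∧ z ∈ gap x j := by
  obtain ⟨j, hj, hmax⟩ := Set.exists_max_image {j | x j < z} x (Set.toFinite _) ⟨k, hk⟩
  exact ⟨j, hmax k hk, hj, fun i hi => (hz i).lt_of_le (not_lt.1 fun h => (hmax i h).not_gt hi)⟩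

theorem gap_mem_nhdsGT (x : K → ℝ) (k : K) : gap x k ∈ 𝓝[>] x k := by
  have hnext : ∀ᶠ z in 𝓝[>] x k, ∀ j, x k < x j → z < x j :=
    eventually_all.2 fun j => eventually_imp_distrib_left.2 fun hj =>
      eventually_nhdsWithin_of_eventually_nhds (eventually_lt_nhds hj)
  filter_upwards [self_mem_nhdsWithin, hnext] with z hkz hz using ⟨hkz, hz⟩

theorem exists_gap_mem_nhdsLT (h : ∃ j, x k < x j) : ∃ j, gap x k ∈ 𝓝[<] x j := by
  obtain ⟨i, hi⟩ := h
  obtain ⟨j, hj, hmin⟩ := Set.exists_min_image {j | x k < x j} x (Set.toFinite _) ⟨i, hi⟩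
  exact ⟨j, mem_of_superset (Ioo_mem_nhdsLT hj) fun z hz =>
    ⟨hz.1, fun i hi => hz.2.trans_le (hmin i hi)⟩⟩

end Finite

theorem existsUnique_mem_gap_pickFun_eq_zero [Fintype K] {s b : ℝ} {c : K → ℝ} (hs : 0 ≤ s)
    (hc : ∀ k, 0 < c k) (hx : Function.Injective x) (h : (∃ j, x k < x j) ∨ s ≠ 0 ∨ 0 < b) :
    ∃! z, z ∈ gap x k ∧ pickFun s b c x z = 0 := by
  have : Nonempty K := ⟨k⟩
  have hpole : ∀ z ∈ gap x k, ∀ j, z ≠ x j := fun _ => ne_of_mem_gap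
  obtain ⟨y, hyneg, hy⟩ := (((tendsto_pickFun_nhdsGT (s := s) (b := b) hc hx k).eventually_lt_atBot
    0).and (gap_mem_nhdsGT x k)).exists
  obtain ⟨w, hwpos, hw⟩ : ∃ w, 0 < pickFun s b c x w ∧ w ∈ gap x k := by
    by_cases hnext : ∃ j, x k < x j
    · obtain ⟨j, hj⟩ := exists_gap_mem_nhdsLT hnext
      exact (((tendsto_pickFun_nhdsLT hc hx j).eventually_gt_atTop 0).and hj).exists
    · refine ((eventually_pickFun_pos hs (h.resolve_left hnext)).and ?_).exists
      filter_upwards [eventually_gt_atTop (x k)] with z hz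
        using ⟨hz, fun j hj => absurd ⟨j, hj⟩ hnext⟩
  obtain ⟨z, hz, hz0⟩ := (convex_gap x k).isPreconnected.intermediate_value hy hw
    (continuousOn_pickFun hpole) ⟨hyneg.le, hwpos.le⟩
  exact ⟨z, ⟨hz, hz0⟩, fun z' hz' => (strictMonoOn_pickFun hs hc (convex_gap x k) hpole).injOn
    hz'.1 hz (hz'.2.trans hz0.symm)⟩

end Gap

namespace HyperexpParams

variable {N N' : ℕ} (p : HyperexpParams N N') {q z : ℝ}

/-- The poles `0, ρ_l, -ρHat_l` of `z ↦ (ψ(z) - q) / z`. -/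
def pole : Fin (N + 1) ⊕ Fin N' → ℝ :=
  Sum.elim (Fin.cons 0 p.ρ) fun l => -p.ρHat l

/-- The weights `q, a_l, aHat_l` of the poles of `z ↦ (ψ(z) - q) / z`. -/
def poleWeight (q : ℝ) : Fin (N + 1) ⊕ Fin N' → ℝ :=
  Sum.elim (Fin.cons q p.a) p.aHat

/-- The function `z ↦ (ψ(z) - q) / z`, as a Pick function. -/
def quotFun (q : ℝ) : ℝ → ℝ :=
  pickFun (p.σ ^ 2 / 2) p.drift (p.poleWeight q) p.pole

theorem pole_inl_zero : p.pole (.inl 0) = 0 := rfl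

theorem pole_inr_neg (l : Fin N') : p.pole (.inr l) < 0 :=
  neg_neg_of_pos (p.ρHat_pos l)

theorem strictMono_pole_inl : StrictMono fun i => p.pole (.inl i) :=
  Fin.strictMono_cons.2 ⟨p.ρ_pos, p.ρ_strictMono⟩

theorem pole_inl_nonneg (i : Fin (N + 1)) : 0 ≤ p.pole (.inl i) :=
  p.strictMono_pole_inl.monotone (Fin.zero_le i)

theorem pole_injective : Function.Injective p.pole :=
  p.strictMono_pole_inl.injective.sumElim (neg_injective.comp p.ρHat_strictMono.injective)
    fun i l => ((p.pole_inr_neg l).trans_le (p.pole_inl_nonneg i)).ne'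

theorem poleWeight_pos (hq : 0 < q) (k : Fin (N + 1) ⊕ Fin N') : 0 < p.poleWeight q k :=
  match k with
  | .inl i => Fin.cases hq p.a_pos i
  | .inr l => p.aHat_pos l

theorem psi_eq_add_mul_quotFun (q : ℝ) (hz : z ≠ 0) : p.psi z = q + z * p.quotFun q z := by
  have hρ (l : Fin N) : p.a l / (p.ρ l - z) = -(p.a l / (z - p.ρ l)) := by
    rw [← div_neg, neg_sub]
  simp only [psi, quotFun, pickFun, pole, poleWeight, Fintype.sum_sum_type, Sum.elim_inl,
    Sum.elim_inr, Fin.sum_univ_succ, Fin.cons_zero, Fin.cons_succ, hρ, sub_zero,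
    Finset.sum_neg_distrib, sub_neg_eq_add, add_comm z]
  field_simp
  ring

theorem ne_zero_of_mem_solutions (hq : q ≠ 0) (hz : z ∈ p.solutions q) : z ≠ 0 := by
  rintro rfl
  exact hq (by simpa [psi] using hz.2.2.symm)

theorem mem_solutions_iff (hq : q ≠ 0) :
    z ∈ p.solutions q ↔ (∀ k, z ≠ p.pole k) ∧ p.quotFun q z = 0 := by
  have hpole : (∀ k, z ≠ p.pole k) ↔ z ≠ 0 ∧ (∀ l, z ≠ p.ρ l) ∧ ∀ l, z ≠ -p.ρHat l := by
    simp [pole, Fin.forall_fin_succ, and_assoc]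
  rw [hpole]
  by_cases hz : z = 0
  · exact iff_of_false (fun h => p.ne_zero_of_mem_solutions hq h hz) fun h => h.1.1 hz
  · simp [solutions, p.psi_eq_add_mul_quotFun q hz, hz, and_assoc]

theorem deriv_psi_of_mem_solutions (hq : q ≠ 0) (hz : z ∈ p.solutions q) :
    deriv p.psi z = z * pickFunDeriv (p.σ ^ 2 / 2) (p.poleWeight q) p.pole z := by
  obtain ⟨hpole, hzero⟩ := (p.mem_solutions_iff hq).1 hz
  have hpsi : p.psi =ᶠ[𝓝 z] fun y => q + y * p.quotFun q y := by
    filter_upwards [isOpen_ne.mem_nhds (p.ne_zero_of_mem_solutions hq hz)] with y hy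
      using p.psi_eq_add_mul_quotFun q hy
  have hderiv := ((hasDerivAt_id z).mul
    (hasDerivAt_pickFun (p.σ ^ 2 / 2) p.drift (p.poleWeight q) hpole)).const_add q
  rw [hpsi.deriv_eq]
  refine hderiv.deriv.trans ?_
  change 1 * p.quotFun q z + z * _ = _
  rw [hzero, mul_zero, zero_add]

theorem mul_deriv_psi_pos (hq : 0 < q) (hz : z ∈ p.solutions q) : 0 < z * deriv p.psi z := by
  have hz0 := p.ne_zero_of_mem_solutions hq.ne' hz
  have hderiv := pickFunDeriv_pos (by positivity : 0 ≤ p.σ ^ 2 / 2) (p.poleWeight_pos hq)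
    ((p.mem_solutions_iff hq.ne').1 hz).1
  rw [p.deriv_psi_of_mem_solutions hq.ne' hz, ← mul_assoc]
  exact mul_pos (mul_self_pos.2 hz0) hderiv

theorem numPos_le : p.numPos ≤ N + 1 := by
  unfold numPos
  split_ifs <;> omega

theorem lt_numPos_iff (i : Fin (N + 1)) :
    i < p.numPos ↔ (∃ k, p.pole (.inl i) < p.pole k) ∨ p.σ ^ 2 / 2 ≠ 0 ∨ 0 < p.drift := by
  by_cases hcond : p.σ ≠ 0 ∨ 0 < p.drift
  · simp [numPos, hcond, i.is_lt]
  · have : ¬(p.σ ^ 2 / 2 ≠ 0 ∨ 0 < p.drift) := by simpa using hcond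
    simp only [numPos, hcond, this, if_false, or_false]
    constructor
    · exact fun hi => ⟨.inl (Fin.last N), p.strictMono_pole_inl (Fin.lt_last_iff_ne_last.2
        fun h => hi.ne (by simp [h]))⟩
    · rintro ⟨j | l, hk⟩
      · exact (Fin.lt_def.1 (p.strictMono_pole_inl.lt_iff_lt.1 hk)).trans_le (Fin.le_last j)
      · linarith [p.pole_inl_nonneg i, p.pole_inr_neg l]

theorem exists_positive_solutions (hq : 0 < q) :
    ∃ ζ : Fin p.numPos → ℝ, StrictMono ζ ∧ Set.range ζ = {z | 0 < z ∧ z ∈ p.solutions q} := by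
  have hs : 0 ≤ p.σ ^ 2 / 2 := by positivity
  have hc := p.poleWeight_pos hq
  have hgap (i : Fin p.numPos) := existsUnique_mem_gap_pickFun_eq_zero hs hc p.pole_injective
    ((p.lt_numPos_iff (Fin.castLE p.numPos_le i)).1 i.is_lt)
  choose ζ hζ hunique using hgap
  refine ⟨ζ, fun i j hij => lt_of_mem_gap_of_lt (hζ i).1 (hζ j).1
    (p.strictMono_pole_inl (Fin.castLE_lt_castLE_iff p.numPos_le |>.2 hij)), ?_⟩
  ext z
  constructor
  · rintro ⟨i, rfl⟩
    exact ⟨(p.pole_inl_nonneg _).trans_lt (hζ i).1.1,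
      (p.mem_solutions_iff hq.ne').2 ⟨ne_of_mem_gap (hζ i).1, (hζ i).2⟩⟩
  · rintro ⟨hz, hsol⟩
    obtain ⟨hpole, hzero⟩ := (p.mem_solutions_iff hq.ne').1 hsol
    obtain ⟨i | l, hk, hzgap⟩ := exists_mem_gap (p.pole_inl_zero.trans_lt hz) hpole
    · have hi : i < p.numPos := (p.lt_numPos_iff i).2 <| by
        by_contra! h
        refine (pickFun_neg_of_forall_lt h.2.1 h.2.2 hc fun k => ?_).ne hzero
        exact (h.1 k).trans_lt hzgap.1
      exact ⟨⟨i, hi⟩, (hunique ⟨i, hi⟩ z ⟨hzgap, hzero⟩).symm⟩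
    · exact absurd hk (p.pole_inr_neg l).not_ge

/-- The parameters of the process `-X`. -/
def dual : HyperexpParams N' N where
  σ := p.σ
  drift := -p.drift
  a := p.aHat
  ρ := p.ρHat
  aHat := p.a
  ρHat := p.ρ
  σ_nonneg := p.σ_nonneg
  a_pos := p.aHat_pos
  ρ_pos := p.ρHat_pos
  ρ_strictMono := p.ρHat_strictMono
  aHat_pos := p.a_pos
  ρHat_pos := p.ρ_pos
  ρHat_strictMono := p.ρ_strictMono

theorem psi_dual (z : ℝ) : p.dual.psi z = p.psi (-z) := by
  simp only [psi, dual, sub_eq_add_neg, neg_neg]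
  ring

theorem numPos_dual : p.dual.numPos = p.numNeg := by
  simp [numPos, numNeg, dual]

theorem mem_solutions_dual : z ∈ p.dual.solutions q ↔ -z ∈ p.solutions q := by
  simp only [solutions, Set.mem_ofPred_eq, psi_dual]
  simp only [dual, ne_eq, neg_eq_iff_eq_neg, neg_neg]
  tauto

theorem exists_negative_solutions (hq : 0 < q) :
    ∃ ζHat : Fin p.numNeg → ℝ,
      StrictMono ζHat ∧ Set.range ζHat = {z | 0 < z ∧ -z ∈ p.solutions q} := by
  rw [← numPos_dual]
  simpa only [mem_solutions_dual] using p.dual.exists_positive_solutions hq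

end HyperexpParams

section PartialFraction

open Polynomial Lagrange

theorem exists_eq_C_mul_nodal {F R : Type*} [Field F] [Fintype R] {r : R → F}
    (hr : Function.Injective r) {P : F[X]} (hroot : ∀ i, P.eval (r i) = 0)
    (hP : P.degree ≤ Fintype.card R) : ∃ a, P = C a * nodal Finset.univ r := by
  have hdvd : nodal Finset.univ r ∣ P := Fintype.prod_dvd_of_coprime
    (pairwise_coprime_X_sub_C hr) fun i => dvd_iff_isRoot.2 (hroot i)
  obtain ⟨Q, hQ⟩ := hdvd
  rcases eq_or_ne Q 0 with rfl | hQ0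
  · exact ⟨0, by simp [hQ]⟩
  have hdeg : Q.degree ≤ 0 := by
    rw [hQ, degree_mul, degree_nodal, degree_eq_natDegree hQ0, Finset.card_univ] at hP
    rw [degree_eq_natDegree hQ0]
    norm_cast at hP ⊢
    lia
  exact ⟨Q.coeff 0, by rw [← eq_C_of_degree_le_zero hdeg, hQ, mul_comm]⟩

theorem eval_div_eval_eq_sum {F R : Type*} [Field F] [Fintype R] {r : R → F}
    (hr : Function.Injective r) {f P : F[X]} (hroot : ∀ i, P.eval (r i) = 0)
    (hP : P.degree ≤ Fintype.card R) (hf : f.degree < Fintype.card R) {z : F}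
    (hz : P.eval z ≠ 0) :
    f.eval z / P.eval z = ∑ i, f.eval (r i) / (P.derivative.eval (r i) * (z - r i)) := by
  classical
  obtain ⟨a, rfl⟩ := exists_eq_C_mul_nodal hr hroot hP
  have hzr : ∀ i ∈ Finset.univ, z ≠ r i := fun i _ h => hz (h ▸ hroot i)
  have hinterp := congrArg (eval z) (eq_interpolate hr.injOn hf)
  rw [eval_interpolate_not_at_node _ hzr] at hinterp
  rw [hinterp, eval_mul, eval_C, mul_comm a,
    mul_div_mul_left _ _ (right_ne_zero_of_mul (by simpa using hz)), Finset.sum_div]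
  refine Finset.sum_congr rfl fun i hi => ?_
  rw [nodalWeight_eq_eval_derivative_nodal hi, derivative_C_mul, eval_mul, eval_C]
  simp only [div_eq_mul_inv, mul_inv]
  ring

variable {K : Type*} [Fintype K] [DecidableEq K]

/-- The numerator of `pickFun s b c x` over the denominator `∏ (X - x_k)`. -/
def pickNumerator {F : Type*} [Field F] (s b : F) (c x : K → F) : F[X] :=
  (C s * X + C b) * nodal Finset.univ x - ∑ k, C (c k) * nodal (Finset.univ.erase k) x

section Degree

variable {F : Type*} [Field F]

theorem degree_nodal_erase_lt (x : K → F) (k : K) :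
    (nodal (Finset.univ.erase k) x).degree < Fintype.card K := by
  rw [degree_nodal]
  exact_mod_cast Finset.card_lt_univ_of_notMem (Finset.notMem_erase k _)

theorem degree_sum_nodal_erase_lt (c x : K → F) :
    (∑ k, C (c k) * nodal (Finset.univ.erase k) x).degree < Fintype.card K := by
  refine (degree_sum_le _ _).trans_lt ((Finset.sup_lt_iff (WithBot.bot_lt_coe _)).2 fun k _ => ?_)
  rw [← smul_eq_C_mul]
  exact (degree_smul_le _ _).trans_lt (degree_nodal_erase_lt x k)

theorem degree_pickNumerator_le {s b : F} {n : ℕ} (h : (C s * X + C b).degree ≤ (n : WithBot ℕ))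
    (c x : K → F) :
    (pickNumerator s b c x).degree ≤ (n + Fintype.card K : ℕ) := by
  refine (degree_sub_le _ _).trans (max_le ?_ ?_)
  · rw [degree_mul, degree_nodal, Finset.card_univ]
    push_cast
    gcongr
  · exact (degree_sum_nodal_erase_lt c x).le.trans (by exact_mod_cast Nat.le_add_left _ _)

theorem degree_nodal_erase_sub_sum_lt {a : K → F} (ha : ∑ k, a k = 1) (x : K → F) (k₀ : K) {n : ℕ}
    (hn : n + 1 = Fintype.card K) :
    (nodal (Finset.univ.erase k₀) x - ∑ k, C (a k) * nodal (Finset.univ.erase k) x).degree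
      < n := by
  have hdeg (k : K) : (nodal (Finset.univ.erase k) x).degree = n := by
    rw [degree_nodal, Finset.card_erase_of_mem (Finset.mem_univ k), Finset.card_univ, ← hn]
    rfl
  have hsum : nodal (Finset.univ.erase k₀) x - ∑ k, C (a k) * nodal (Finset.univ.erase k) x =
      ∑ k, a k • (nodal (Finset.univ.erase k₀) x - nodal (Finset.univ.erase k) x) := by
    simp only [smul_sub, Finset.sum_sub_distrib, ← Finset.sum_smul, ha, one_smul]
    simp only [smul_eq_C_mul]
  rw [hsum]
  refine (degree_sum_le _ _).trans_lt ((Finset.sup_lt_iff (WithBot.bot_lt_coe _)).2 fun k _ => ?_)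
  refine (degree_smul_le _ _).trans_lt ?_
  rw [← hdeg k₀]
  exact degree_sub_lt_left ((hdeg k₀).trans (hdeg k).symm) nodal_ne_zero
    (nodal_monic.leadingCoeff.trans nodal_monic.leadingCoeff.symm)

theorem degree_nodal_erase_add_pickNumerator_lt {s b α : F} {c : K → F} {n : ℕ}
    (h : (n = Fintype.card K + 1 ∧ α = 0) ∨ (s = 0 ∧ n = Fintype.card K ∧ α = 0) ∨
      (s = 0 ∧ b = 0 ∧ n + 1 = Fintype.card K ∧ α * ∑ k, c k = 1)) (x : K → F) (k₀ : K) :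
    (pickNumerator s b c x).degree ≤ n ∧
      (nodal (Finset.univ.erase k₀) x + C α * pickNumerator s b c x).degree < n := by
  rcases h with ⟨rfl, rfl⟩ | ⟨rfl, rfl, rfl⟩ | ⟨rfl, rfl, hn, hα⟩
  · refine ⟨?_, ?_⟩
    · simpa only [add_comm 1] using degree_pickNumerator_le (n := 1) degree_linear_le c x
    · simpa using (degree_nodal_erase_lt x k₀).trans (by exact_mod_cast Nat.lt_succ_self _)
  · refine ⟨?_, ?_⟩
    · have hconst : (C 0 * X + C b).degree ≤ ((0 : ℕ) : WithBot ℕ) := by simpa using degree_C_le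
      simpa using degree_pickNumerator_le hconst c x
    · simpa using degree_nodal_erase_lt x k₀
  · have hP : pickNumerator 0 0 c x = -∑ k, C (c k) * nodal (Finset.univ.erase k) x := by
      simp [pickNumerator]
    constructor
    · rw [hP, degree_neg]
      refine not_lt.1 fun hlt => (Nat.WithBot.add_one_le_of_lt hlt).not_gt ?_
      exact_mod_cast hn ▸ degree_sum_nodal_erase_lt c x
    · simpa [hP, Finset.mul_sum, ← mul_assoc, sub_eq_add_neg] using
        degree_nodal_erase_sub_sum_lt (a := fun k => α * c k) (by rw [← Finset.mul_sum, hα])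
          x k₀ hn

theorem eval_pickNumerator (s b : F) (c : K → F) {x : K → F} {z : F} (hz : ∀ k, z ≠ x k) :
    (pickNumerator s b c x).eval z = pickFun s b c x z * (nodal Finset.univ x).eval z := by
  simp only [pickNumerator, pickFun, eval_sub, eval_mul, eval_add, eval_C, eval_X, eval_finsetSum,
    sub_mul, Finset.sum_mul]
  congr 1
  refine Finset.sum_congr rfl fun k hk => ?_
  rw [nodal_eq_mul_nodal_erase hk, eval_mul, eval_sub, eval_X, eval_C, ← mul_assoc,
    div_mul_cancel₀ _ (sub_ne_zero.2 (hz k))]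

end Degree

variable {𝕜 : Type*} [NontriviallyNormedField 𝕜] {s b : 𝕜} {c x : K → 𝕜}

theorem eval_derivative_pickNumerator {z : 𝕜} (hz : ∀ k, z ≠ x k)
    (hzero : pickFun s b c x z = 0) :
    (pickNumerator s b c x).derivative.eval z =
      pickFunDeriv s c x z * (nodal Finset.univ x).eval z := by
  have hderiv := (hasDerivAt_pickFun s b c hz).mul ((nodal Finset.univ x).hasDerivAt z)
  rw [hzero, zero_mul, add_zero] at hderiv
  refine ((pickNumerator s b c x).hasDerivAt z).unique (hderiv.congr_of_eventuallyEq ?_)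
  filter_upwards [eventually_all.2 fun k => isOpen_ne.mem_nhds (hz k)] with y hy
    using eval_pickNumerator s b c hy

theorem inv_sub_mul_pickFun_eq_sum {R : Type*} [Fintype R] {r : R → 𝕜} {α : 𝕜}
    (hr : Function.Injective r) (hpole : ∀ i k, r i ≠ x k) (hzero : ∀ i, pickFun s b c x (r i) = 0)
    (k₀ : K) (hP : (pickNumerator s b c x).degree ≤ Fintype.card R)
    (hα : (nodal (Finset.univ.erase k₀) x + C α * pickNumerator s b c x).degree < Fintype.card R)
    {z : 𝕜} (hz : ∀ k, z ≠ x k) (hz0 : pickFun s b c x z ≠ 0) :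
    ((z - x k₀) * pickFun s b c x z)⁻¹ =
      -α + ∑ i, ((r i - x k₀) * pickFunDeriv s c x (r i) * (z - r i))⁻¹ := by
  set P := pickNumerator s b c x
  set E := nodal (Finset.univ.erase k₀) x
  have hnodal (y : 𝕜) : (nodal Finset.univ x).eval y = (y - x k₀) * E.eval y := by
    rw [nodal_eq_mul_nodal_erase (Finset.mem_univ k₀)]
    simp [E]
  have hE {y : 𝕜} (hy : ∀ k, y ≠ x k) : E.eval y ≠ 0 := eval_nodal_not_at_node fun k _ => hy k
  have hroot (i : R) : P.eval (r i) = 0 := by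
    rw [eval_pickNumerator s b c (hpole i), hzero, zero_mul]
  have hPz : P.eval z = (z - x k₀) * pickFun s b c x z * E.eval z := by
    rw [eval_pickNumerator s b c hz, hnodal]
    ring
  have hPz0 : P.eval z ≠ 0 :=
    hPz ▸ mul_ne_zero (mul_ne_zero (sub_ne_zero.2 (hz k₀)) hz0) (hE hz)
  have hsum := eval_div_eval_eq_sum hr hroot hP hα hPz0
  rw [eval_add, eval_mul, eval_C, add_div, mul_div_cancel_right₀ _ hPz0, hPz,
    div_mul_cancel_right₀ (hE hz)] at hsum
  rw [eq_neg_add_iff_add_eq, add_comm, hsum]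
  refine Finset.sum_congr rfl fun i _ => ?_
  rw [eval_derivative_pickNumerator (hpole i) (hzero i), eval_add, eval_mul, hroot, mul_zero,
    add_zero, hnodal]
  field_simp [hE (hpole i)]

end PartialFraction

section TwoSidedExp

variable {R R' : Type*} [Fintype R] [Fintype R'] {w u : R → ℝ} {w' u' : R' → ℝ}

/-- The density of a mixture of exponential distributions on the two half-lines, with weights `w`
and rates `u` on the positive half-line and weights `w'` and rates `u'` on the negative one. It
takes the value `0` at the origin. -/
def twoSidedExp (w u : R → ℝ) (w' u' : R' → ℝ) (x : ℝ) : ℝ :=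
  (if 0 < x then ∑ l, w l * Real.exp (-(u l) * x) else 0) +
    (if x < 0 then ∑ l, w' l * Real.exp (u' l * x) else 0)

theorem twoSidedExp_nonneg (hw : ∀ l, 0 ≤ w l) (hw' : ∀ l, 0 ≤ w' l) (x : ℝ) :
    0 ≤ twoSidedExp w u w' u' x := by
  have hpos : 0 ≤ ∑ l, w l * Real.exp (-(u l) * x) :=
    Finset.sum_nonneg fun l _ => mul_nonneg (hw l) (Real.exp_pos _).le
  have hneg : 0 ≤ ∑ l, w' l * Real.exp (u' l * x) :=
    Finset.sum_nonneg fun l _ => mul_nonneg (hw' l) (Real.exp_pos _).le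
  unfold twoSidedExp
  positivity

theorem measurable_twoSidedExp : Measurable (twoSidedExp w u w' u') := by
  refine Measurable.add (Measurable.ite measurableSet_Ioi ?_ measurable_const)
    (Measurable.ite measurableSet_Iio ?_ measurable_const) <;> fun_prop

theorem integrableOn_sum_cexp_Ioi (w : R → ℝ) (hu : ∀ l, 0 < u l) (θ : ℝ) : IntegrableOn
    (fun x : ℝ => ∑ l, w l * Complex.exp ((-(u l) + Complex.I * θ) * x)) (Set.Ioi 0) :=
  integrable_finsetSum _ fun l _ =>
    (integrableOn_exp_mul_complex_Ioi (by simpa using hu l) 0).const_mul _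

theorem integrableOn_sum_cexp_Iio (w' : R' → ℝ) (hu' : ∀ l, 0 < u' l) (θ : ℝ) : IntegrableOn
    (fun x : ℝ => ∑ l, w' l * Complex.exp ((u' l + Complex.I * θ) * x)) (Set.Iio 0) :=
  integrable_finsetSum _ fun l _ =>
    ((integrableOn_exp_mul_complex_Iic (by simpa using hu' l) 0).mono_set
      Set.Iio_subset_Iic_self).const_mul _

theorem integral_sum_cexp_Ioi (w : R → ℝ) (hu : ∀ l, 0 < u l) (θ : ℝ) :
    ∫ x : ℝ in Set.Ioi 0, ∑ l, w l * Complex.exp ((-(u l) + Complex.I * θ) * x) =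
      ∑ l, w l / (u l - Complex.I * θ) := by
  have hre (l : R) : (-(u l : ℂ) + Complex.I * θ).re < 0 := by simpa using hu l
  rw [integral_finsetSum _ fun l _ => (integrableOn_exp_mul_complex_Ioi (hre l) 0).const_mul _]
  refine Finset.sum_congr rfl fun l _ => ?_
  rw [integral_const_mul, integral_exp_mul_complex_Ioi (hre l), neg_div, ← div_neg]
  simp [div_eq_mul_inv, sub_eq_add_neg, add_comm]

theorem integral_sum_cexp_Iio (w' : R' → ℝ) (hu' : ∀ l, 0 < u' l) (θ : ℝ) :
    ∫ x : ℝ in Set.Iio 0, ∑ l, w' l * Complex.exp ((u' l + Complex.I * θ) * x) =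
      ∑ l, w' l / (u' l + Complex.I * θ) := by
  have hre (l : R') : 0 < (u' l + Complex.I * θ : ℂ).re := by simpa using hu' l
  rw [← integral_Iic_eq_integral_Iio,
    integral_finsetSum _ fun l _ => (integrableOn_exp_mul_complex_Iic (hre l) 0).const_mul _]
  refine Finset.sum_congr rfl fun l _ => ?_
  rw [integral_const_mul, integral_exp_mul_complex_Iic (hre l)]
  simp [div_eq_mul_inv]

theorem twoSidedExp_mul_cexp (θ x : ℝ) :
    (twoSidedExp w u w' u' x : ℂ) * Complex.exp (θ * x * Complex.I) =
      (Set.Ioi (0 : ℝ)).indicator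
          (fun x : ℝ => ∑ l, w l * Complex.exp ((-(u l) + Complex.I * θ) * x)) x +
        (Set.Iio (0 : ℝ)).indicator
          (fun x : ℝ => ∑ l, w' l * Complex.exp ((u' l + Complex.I * θ) * x)) x := by
  rw [show θ * x * Complex.I = Complex.I * θ * x by ring]
  simp only [twoSidedExp, Set.indicator_apply, Set.mem_Ioi, Set.mem_Iio, Complex.ofReal_add,
    add_mul (Complex.ofReal _)]
  congr 1 <;> split_ifs <;> simp [Finset.sum_mul, add_mul, Complex.exp_add, mul_assoc]

theorem integrable_twoSidedExp (hu : ∀ l, 0 < u l) (hu' : ∀ l, 0 < u' l) :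
    Integrable (twoSidedExp w u w' u') := by
  have h : Integrable fun x : ℝ =>
      (twoSidedExp w u w' u' x : ℂ) * Complex.exp ((0 : ℝ) * x * Complex.I) := by
    simp only [twoSidedExp_mul_cexp]
    exact ((integrableOn_sum_cexp_Ioi w hu 0).integrable_indicator measurableSet_Ioi).add
      ((integrableOn_sum_cexp_Iio w' hu' 0).integrable_indicator measurableSet_Iio)
  simpa using h.re

theorem isFiniteMeasure_withDensity_twoSidedExp (hu : ∀ l, 0 < u l) (hu' : ∀ l, 0 < u' l) :
    IsFiniteMeasure (volume.withDensity fun x => ENNReal.ofReal (twoSidedExp w u w' u' x)) :=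
  isFiniteMeasure_withDensity_ofReal (integrable_twoSidedExp hu hu').2

theorem charFun_withDensity_twoSidedExp (hw : ∀ l, 0 ≤ w l) (hw' : ∀ l, 0 ≤ w' l)
    (hu : ∀ l, 0 < u l) (hu' : ∀ l, 0 < u' l) (θ : ℝ) :
    charFun (volume.withDensity fun x => ENNReal.ofReal (twoSidedExp w u w' u' x)) θ =
      ∑ l, w l / (u l - Complex.I * θ) + ∑ l, w' l / (u' l + Complex.I * θ) := by
  rw [charFun_apply_real, integral_withDensity_eq_integral_toReal_smul
    measurable_twoSidedExp.ennreal_ofReal (ae_of_all _ fun _ => ENNReal.ofReal_lt_top)]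
  simp only [ENNReal.toReal_ofReal (twoSidedExp_nonneg hw hw' _), Complex.real_smul,
    twoSidedExp_mul_cexp]
  rw [integral_add ((integrableOn_sum_cexp_Ioi w hu θ).integrable_indicator measurableSet_Ioi)
    ((integrableOn_sum_cexp_Iio w' hu' θ).integrable_indicator measurableSet_Iio),
    integral_indicator measurableSet_Ioi, integral_indicator measurableSet_Iio,
    integral_sum_cexp_Ioi w hu, integral_sum_cexp_Iio w' hu']

end TwoSidedExp

theorem ofReal_pickFun {K : Type*} [Fintype K] (s b : ℝ) (c x : K → ℝ) (z : ℝ) :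
    ((pickFun s b c x z : ℝ) : ℂ) =
      pickFun (s : ℂ) b (fun k => (c k : ℂ)) (fun k => (x k : ℂ)) z := by
  simp [pickFun]

theorem ofReal_pickFunDeriv {K : Type*} [Fintype K] (s : ℝ) (c x : K → ℝ) (z : ℝ) :
    ((pickFunDeriv s c x z : ℝ) : ℂ) =
      pickFunDeriv (s : ℂ) (fun k => (c k : ℂ)) (fun k => (x k : ℂ)) z := by
  simp [pickFunDeriv]

theorem I_mul_ofReal_ne_ofReal {θ : ℝ} (hθ : θ ≠ 0) (y : ℝ) : Complex.I * θ ≠ y := fun h =>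
  hθ (by simpa using congrArg Complex.im h)

namespace HyperexpParams

variable {N N' : ℕ} (p : HyperexpParams N N')

theorem levyDensity_eq_twoSidedExp : p.levyDensity =
    twoSidedExp (fun l => p.a l * p.ρ l) p.ρ (fun l => p.aHat l * p.ρHat l) p.ρHat := by
  ext x
  rw [levyDensity, twoSidedExp, add_comm]

theorem isFiniteMeasure_levyMeasure : IsFiniteMeasure p.levyMeasure := by
  rw [levyMeasure, levyDensity_eq_twoSidedExp]
  exact isFiniteMeasure_withDensity_twoSidedExp p.ρ_pos p.ρHat_pos

theorem charFun_levyMeasure (θ : ℝ) : charFun p.levyMeasure θ =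
    ∑ l, p.a l * p.ρ l / (p.ρ l - Complex.I * θ) +
      ∑ l, p.aHat l * p.ρHat l / (p.ρHat l + Complex.I * θ) := by
  rw [levyMeasure, levyDensity_eq_twoSidedExp, charFun_withDensity_twoSidedExp
    (fun l => (mul_pos (p.a_pos l) (p.ρ_pos l)).le)
    (fun l => (mul_pos (p.aHat_pos l) (p.ρHat_pos l)).le) p.ρ_pos p.ρHat_pos]
  push_cast
  rfl

theorem levyKhintchine_eq_charFun (θ : ℝ) : p.levyKhintchine θ =
    Complex.I * p.drift * θ - p.σ ^ 2 * θ ^ 2 / 2 +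
      (charFun p.levyMeasure θ - charFun p.levyMeasure 0) := by
  have := p.isFiniteMeasure_levyMeasure
  have hint : Integrable (fun x : ℝ => Complex.exp (θ * x * Complex.I)) p.levyMeasure :=
    .of_bound (by fun_prop) 1 (ae_of_all _ fun x => by
      rw [← Complex.ofReal_mul, Complex.norm_exp_ofReal_mul_I])
  have hcomm (x : ℝ) : Complex.I * θ * x = θ * x * Complex.I := by ring
  simp only [levyKhintchine, hcomm, charFun_apply_real, Complex.ofReal_zero, zero_mul,
    Complex.exp_zero]
  rw [integral_sub hint (integrable_const 1)]

theorem levyKhintchine_re_nonpos (θ : ℝ) : (p.levyKhintchine θ).re ≤ 0 := by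
  have := p.isFiniteMeasure_levyMeasure
  have hν : (charFun p.levyMeasure θ).re ≤ p.levyMeasure.real Set.univ :=
    (Complex.re_le_norm _).trans (norm_charFun_le θ)
  have hgauss : (p.σ ^ 2 * θ ^ 2 / 2 : ℂ).re = p.σ ^ 2 * θ ^ 2 / 2 := by norm_cast
  have hsq : 0 ≤ p.σ ^ 2 * θ ^ 2 / 2 := by positivity
  rw [levyKhintchine_eq_charFun, charFun_zero, Complex.add_re, Complex.sub_re, Complex.sub_re,
    hgauss, Complex.ofReal_re]
  have hdrift : (Complex.I * p.drift * θ : ℂ).re = 0 := by simp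
  linarith

/-- The function `z ↦ (ψ(z) - q) / z` at complex arguments. -/
def complexQuotFun (q : ℝ) : ℂ → ℂ :=
  pickFun ((p.σ ^ 2 / 2 : ℝ) : ℂ) p.drift (fun k => (p.poleWeight q k : ℂ))
    fun k => (p.pole k : ℂ)

theorem levyKhintchine_eq_add_mul_complexQuotFun (q : ℝ) {θ : ℝ} (hθ : θ ≠ 0) :
    p.levyKhintchine θ = q + Complex.I * θ * p.complexQuotFun q (Complex.I * θ) := by
  have hpos (l : Fin N) : (p.a l * p.ρ l / (p.ρ l - Complex.I * θ) : ℂ) =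
      p.a l - Complex.I * θ * (p.a l / (Complex.I * θ - p.ρ l)) := by
    have h := sub_ne_zero.2 (I_mul_ofReal_ne_ofReal hθ (p.ρ l))
    rw [← neg_sub (Complex.I * θ : ℂ) (p.ρ l)]
    field_simp
    ring
  have hneg (l : Fin N') : (p.aHat l * p.ρHat l / (p.ρHat l + Complex.I * θ) : ℂ) =
      p.aHat l - Complex.I * θ * (p.aHat l / (Complex.I * θ + p.ρHat l)) := by
    have h := sub_ne_zero.2 (I_mul_ofReal_ne_ofReal hθ (-p.ρHat l))
    rw [Complex.ofReal_neg, sub_neg_eq_add] at h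
    rw [add_comm (p.ρHat l : ℂ)]
    field_simp
    ring
  have hpos₀ (l : Fin N) : (p.a l * p.ρ l / p.ρ l : ℂ) = p.a l :=
    mul_div_cancel_right₀ _ (by exact_mod_cast (p.ρ_pos l).ne')
  have hneg₀ (l : Fin N') : (p.aHat l * p.ρHat l / p.ρHat l : ℂ) = p.aHat l :=
    mul_div_cancel_right₀ _ (by exact_mod_cast (p.ρHat_pos l).ne')
  rw [levyKhintchine_eq_charFun, charFun_levyMeasure, charFun_levyMeasure]
  simp only [hpos, hneg, Complex.ofReal_zero, mul_zero, sub_zero, add_zero, hpos₀, hneg₀,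
    Finset.sum_sub_distrib, ← Finset.mul_sum, complexQuotFun, pickFun, pole, poleWeight,
    Fintype.sum_sum_type, Sum.elim_inl, Sum.elim_inr, Fin.sum_univ_succ, Fin.cons_zero,
    Fin.cons_succ, Complex.ofReal_neg, sub_neg_eq_add]
  have hq : Complex.I * θ * (q / (Complex.I * θ)) = (q : ℂ) :=
    mul_div_cancel₀ _ (I_mul_ofReal_ne_ofReal hθ 0)
  push_cast
  linear_combination hq - (p.σ ^ 2 * θ ^ 2 / 2 : ℂ) * Complex.I_sq

end HyperexpParams

section CharFun

variable {E : Type*} [NormedAddCommGroup E] [InnerProductSpace ℝ E] [MeasurableSpace E]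

theorem charFun_add_measure [OpensMeasurableSpace E] (μ ν : Measure E) [IsFiniteMeasure μ]
    [IsFiniteMeasure ν] (t : E) : charFun (μ + ν) t = charFun μ t + charFun ν t := by
  simp only [charFun_eq_integral_innerProbChar]
  exact integral_add_measure (BoundedContinuousFunction.integrable μ _)
    (BoundedContinuousFunction.integrable ν _)

theorem charFun_smul_measure (c : ℝ≥0∞) (μ : Measure E) (t : E) :
    charFun (c • μ) t = c.toReal * charFun μ t := by
  rw [charFun_apply, integral_smul_measure, ← charFun_apply, Complex.real_smul]

end CharFun

namespace HyperexpParams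

open Polynomial Lagrange

variable {N N' : ℕ} (p : HyperexpParams N N') {q : ℝ}

theorem sum_poleWeight (q : ℝ) : ∑ k, p.poleWeight q k = q + ∑ l, p.a l + ∑ l, p.aHat l := by
  simp [poleWeight, Fin.sum_univ_succ]

theorem sum_poleWeight_pos (hq : 0 < q) : 0 < ∑ k, p.poleWeight q k :=
  Finset.sum_pos (fun k _ => p.poleWeight_pos hq k) ⟨.inl 0, Finset.mem_univ _⟩

theorem gam_eq_inv_sum_poleWeight (q : ℝ) : p.gam q = (∑ k, p.poleWeight q k)⁻¹ := by
  rw [gam, sum_poleWeight, one_div]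

theorem alpha_nonneg (hq : 0 < q) : 0 ≤ p.alpha q := by
  rw [alpha, gam_eq_inv_sum_poleWeight]
  have := p.sum_poleWeight_pos hq
  split_ifs <;> positivity

theorem numPos_add_numNeg_cases (hq : 0 < q) :
    (p.numPos + p.numNeg = Fintype.card (Fin (N + 1) ⊕ Fin N') + 1 ∧ p.alpha q = 0) ∨
      (p.σ ^ 2 / 2 = 0 ∧ p.numPos + p.numNeg = Fintype.card (Fin (N + 1) ⊕ Fin N') ∧
        p.alpha q = 0) ∨
      (p.σ ^ 2 / 2 = 0 ∧ p.drift = 0 ∧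
        p.numPos + p.numNeg + 1 = Fintype.card (Fin (N + 1) ⊕ Fin N') ∧
        p.alpha q * ∑ k, p.poleWeight q k = 1) := by
  rw [Fintype.card_sum, Fintype.card_fin, Fintype.card_fin]
  by_cases hσ : p.σ = 0
  · have hσ₂ : p.σ ^ 2 / 2 = 0 := by simp [hσ]
    rcases lt_trichotomy p.drift 0 with hd | hd | hd
    · have hcard : p.numPos = N ∧ p.numNeg = N' + 1 := by simp [numPos, numNeg, hσ, hd, hd.not_gt]
      exact .inr (.inl ⟨hσ₂, by lia, by simp [alpha, hd.ne]⟩)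
    · have hcard : p.numPos = N ∧ p.numNeg = N' := by simp [numPos, numNeg, hσ, hd]
      refine .inr (.inr ⟨hσ₂, hd, by lia, ?_⟩)
      rw [alpha, if_pos ⟨by simp [hσ], hd⟩, gam_eq_inv_sum_poleWeight,
        inv_mul_cancel₀ (p.sum_poleWeight_pos hq).ne']
    · have hcard : p.numPos = N + 1 ∧ p.numNeg = N' := by simp [numPos, numNeg, hσ, hd, hd.not_gt]
      exact .inr (.inl ⟨hσ₂, by lia, by simp [alpha, hd.ne']⟩)
  · have hcard : p.numPos = N + 1 ∧ p.numNeg = N' + 1 := by simp [numPos, numNeg, hσ]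
    exact .inl ⟨by lia, by simp [alpha, hσ]⟩

theorem sub_levyKhintchine_ne_zero (hq : 0 < q) (θ : ℝ) : q - p.levyKhintchine θ ≠ 0 := fun h => by
  have hre := p.levyKhintchine_re_nonpos θ
  rw [← sub_eq_zero.1 h, Complex.ofReal_re] at hre
  exact hq.not_ge hre

theorem degree_nodal_erase_add_complex_pickNumerator_lt (hq : 0 < q) :
    let P := pickNumerator ((p.σ ^ 2 / 2 : ℝ) : ℂ) p.drift (fun k => (p.poleWeight q k : ℂ))
      fun k => (p.pole k : ℂ)
    P.degree ≤ (p.numPos + p.numNeg : ℕ) ∧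
      (nodal (Finset.univ.erase (.inl 0)) (fun k => (p.pole k : ℂ)) + C (p.alpha q : ℂ) * P).degree
        < (p.numPos + p.numNeg : ℕ) := by
  refine degree_nodal_erase_add_pickNumerator_lt ?_ _ _
  rcases p.numPos_add_numNeg_cases hq with h | h | h
  · exact .inl ⟨h.1, by rw [h.2, Complex.ofReal_zero]⟩
  · exact .inr (.inl ⟨by rw [h.1, Complex.ofReal_zero], h.2.1, by rw [h.2.2, Complex.ofReal_zero]⟩)
  · refine .inr (.inr ⟨by rw [h.1, Complex.ofReal_zero], by rw [h.2.1, Complex.ofReal_zero],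
      h.2.2.1, ?_⟩)
    rw [← Complex.ofReal_sum, ← Complex.ofReal_mul, h.2.2.2, Complex.ofReal_one]

theorem inv_sub_levyKhintchine_eq_sum (hq : 0 < q) {R : Type*} [Fintype R] {r : R → ℝ}
    (hr : Function.Injective r) (hsol : ∀ i, r i ∈ p.solutions q)
    (hcard : Fintype.card R = p.numPos + p.numNeg) {θ : ℝ} (hθ : θ ≠ 0) :
    (q - p.levyKhintchine θ)⁻¹ =
      p.alpha q + ∑ i, (deriv p.psi (r i) * (r i - Complex.I * θ) : ℂ)⁻¹ := by
  have hiff i := (p.mem_solutions_iff hq.ne').1 (hsol i)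
  have hzero (i : R) : p.complexQuotFun q (r i) = 0 := by
    rw [complexQuotFun, ← ofReal_pickFun, Complex.ofReal_eq_zero]
    exact (hiff i).2
  have hquot : q - p.levyKhintchine θ = -(Complex.I * θ * p.complexQuotFun q (Complex.I * θ)) := by
    rw [p.levyKhintchine_eq_add_mul_complexQuotFun q hθ]
    ring
  have hne := right_ne_zero_of_mul (neg_ne_zero.1 (hquot ▸ p.sub_levyKhintchine_ne_zero hq θ))
  obtain ⟨hP, hα⟩ := p.degree_nodal_erase_add_complex_pickNumerator_lt hq
  rw [← hcard] at hP hα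
  have hsum := inv_sub_mul_pickFun_eq_sum (Complex.ofReal_injective.comp hr)
    (fun i k => Complex.ofReal_injective.ne ((hiff i).1 k)) hzero (.inl 0) hP hα
    (fun k => I_mul_ofReal_ne_ofReal hθ _) hne
  simp only [pole_inl_zero, Complex.ofReal_zero, sub_zero, Function.comp_apply,
    ← ofReal_pickFunDeriv] at hsum
  rw [hquot, inv_neg, complexQuotFun, hsum, neg_add, neg_neg, ← Finset.sum_neg_distrib]
  congr 1
  refine Finset.sum_congr rfl fun i _ => ?_
  rw [p.deriv_psi_of_mem_solutions hq.ne' (hsol i), Complex.ofReal_mul, ← inv_neg, ← mul_neg,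
    neg_sub]

theorem deriv_psi_pos (hq : 0 < q) {z : ℝ} (hz : 0 < z) (hsol : z ∈ p.solutions q) :
    0 < deriv p.psi z :=
  (pos_iff_pos_of_mul_pos (p.mul_deriv_psi_pos hq hsol)).1 hz

theorem deriv_psi_neg (hq : 0 < q) {z : ℝ} (hz : z < 0) (hsol : z ∈ p.solutions q) :
    deriv p.psi z < 0 :=
  (neg_iff_neg_of_mul_pos (p.mul_deriv_psi_pos hq hsol)).1 hz

/-- The law of the process at the exponential time: an atom at the origin together with the
density `killedDensity`. -/
def killedLaw {M M' : ℕ} (q : ℝ) (ζ : Fin M → ℝ) (ζHat : Fin M' → ℝ) : Measure ℝ :=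
  ENNReal.ofReal (q * p.alpha q) • Measure.dirac 0 +
    volume.withDensity fun x => ENNReal.ofReal (p.killedDensity q ζ ζHat x)

section KilledLaw

variable {M M' : ℕ} {ζ : Fin M → ℝ} {ζHat : Fin M' → ℝ}

theorem killedDensity_eq_twoSidedExp (q : ℝ) (ζ : Fin M → ℝ) (ζHat : Fin M' → ℝ) :
    p.killedDensity q ζ ζHat =
      twoSidedExp (fun l => q / deriv p.psi (ζ l)) ζ
        (fun l => -(q / deriv p.psi (-ζHat l))) ζHat := by
  ext x
  rw [killedDensity, twoSidedExp, mul_sub, sub_eq_add_neg]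
  congr 1 <;> split_ifs <;>
    simp only [Finset.mul_sum, ← Finset.sum_neg_distrib, mul_zero, neg_zero] <;>
    exact Finset.sum_congr rfl fun l _ => by ring

theorem isFiniteMeasure_withDensity_killedDensity (q : ℝ) (hζ : ∀ l, 0 < ζ l)
    (hζHat : ∀ l, 0 < ζHat l) :
    IsFiniteMeasure (volume.withDensity fun x => ENNReal.ofReal (p.killedDensity q ζ ζHat x)) := by
  rw [killedDensity_eq_twoSidedExp]
  exact isFiniteMeasure_withDensity_twoSidedExp hζ hζHat

theorem isFiniteMeasure_killedLaw (q : ℝ) (hζ : ∀ l, 0 < ζ l) (hζHat : ∀ l, 0 < ζHat l) :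
    IsFiniteMeasure (p.killedLaw q ζ ζHat) := by
  have := p.isFiniteMeasure_withDensity_killedDensity q hζ hζHat
  have := (Measure.dirac (0 : ℝ)).smul_finite (c := ENNReal.ofReal (q * p.alpha q))
    ENNReal.ofReal_ne_top
  rw [killedLaw]
  infer_instance

theorem charFun_killedLaw_eq_sum (hq : 0 < q) (hζ : ∀ l, 0 < ζ l ∧ ζ l ∈ p.solutions q)
    (hζHat : ∀ l, 0 < ζHat l ∧ -ζHat l ∈ p.solutions q) (θ : ℝ) :
    charFun (p.killedLaw q ζ ζHat) θ = q * (p.alpha q +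
      (∑ l, (deriv p.psi (ζ l) * (ζ l - Complex.I * θ) : ℂ)⁻¹ +
        ∑ l, (deriv p.psi (-ζHat l) * ((-ζHat l : ℝ) - Complex.I * θ) : ℂ)⁻¹)) := by
  have hw (l : Fin M) : 0 ≤ q / deriv p.psi (ζ l) :=
    (div_pos hq (p.deriv_psi_pos hq (hζ l).1 (hζ l).2)).le
  have hw' (l : Fin M') : 0 ≤ -(q / deriv p.psi (-ζHat l)) := neg_nonneg.2
    (div_neg_of_pos_of_neg hq (p.deriv_psi_neg hq (neg_neg_of_pos (hζHat l).1) (hζHat l).2)).le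
  have := p.isFiniteMeasure_withDensity_killedDensity q (fun l => (hζ l).1) fun l => (hζHat l).1
  have := (Measure.dirac (0 : ℝ)).smul_finite (c := ENNReal.ofReal (q * p.alpha q))
    ENNReal.ofReal_ne_top
  rw [killedLaw, charFun_add_measure, charFun_smul_measure, killedDensity_eq_twoSidedExp,
    charFun_withDensity_twoSidedExp hw hw' (fun l => (hζ l).1) fun l => (hζHat l).1,
    ENNReal.toReal_ofReal (mul_nonneg hq.le (p.alpha_nonneg hq))]
  simp only [charFun_dirac, inner_zero_left, Complex.ofReal_zero, zero_mul, Complex.exp_zero,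
    mul_one, mul_add (q : ℂ), Finset.mul_sum, Complex.ofReal_mul]
  congr 2 <;> refine Finset.sum_congr rfl fun l _ => ?_
  · rw [mul_inv, Complex.ofReal_div]
    ring
  · rw [Complex.ofReal_neg, Complex.ofReal_div, Complex.ofReal_neg, ← neg_add', mul_neg, inv_neg,
      mul_inv]
    ring

theorem charFun_killedLaw (hq : 0 < q) {ζ : Fin p.numPos → ℝ} {ζHat : Fin p.numNeg → ℝ}
    (hζinj : Function.Injective ζ) (hζ : ∀ l, 0 < ζ l ∧ ζ l ∈ p.solutions q)
    (hζHatinj : Function.Injective ζHat) (hζHat : ∀ l, 0 < ζHat l ∧ -ζHat l ∈ p.solutions q)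
    {θ : ℝ} (hθ : θ ≠ 0) :
    charFun (p.killedLaw q ζ ζHat) θ = q / (q - p.levyKhintchine θ) := by
  have hinj : Function.Injective (Sum.elim ζ fun l => -ζHat l) :=
    hζinj.sumElim (neg_injective.comp hζHatinj) fun i j =>
      ((neg_neg_of_pos (hζHat j).1).trans (hζ i).1).ne'
  rw [p.charFun_killedLaw_eq_sum hq hζ hζHat, div_eq_mul_inv,
    p.inv_sub_levyKhintchine_eq_sum hq hinj (Sum.forall.2 ⟨fun l => (hζ l).2, fun l => (hζHat l).2⟩)
      (by simp) hθ, Fintype.sum_sum_type]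
  rfl

end KilledLaw

end HyperexpParams

section RandomTime

theorem tendsto_ceil_mul_div_nhdsGE (t : ℝ≥0) :
    Tendsto (fun n : ℕ => (⌈t * n⌉₊ / n : ℝ≥0)) atTop (𝓝[≥] t) := by
  have hceil (n : ℕ) : ⌈(t * n : ℝ)⌉₊ = ⌈t * n⌉₊ := eq_of_forall_ge_iff fun m => by
    rw [Nat.ceil_le, Nat.ceil_le]
    norm_cast
  have hlim := (tendsto_nat_ceil_mul_div_atTop t.coe_nonneg).comp tendsto_natCast_atTop_atTop
  refine tendsto_nhdsWithin_iff.2 ⟨NNReal.tendsto_coe.1 (hlim.congr fun n => ?_), ?_⟩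
  · rw [Function.comp_apply, hceil]
    rfl
  · filter_upwards [eventually_gt_atTop 0] with n hn
    have hn' : (0 : ℝ≥0) < n := Nat.cast_pos.2 hn
    exact (le_div_iff₀ hn').2 (Nat.le_ceil _)

variable {Ω E F : Type*} [MeasurableSpace Ω] {P : Measure Ω}

section Countable

variable {ι : Type*} [Countable ι] [MeasurableSpace ι] [DiscreteMeasurableSpace ι] {κ : Ω → ι}

theorem measurable_eval_of_countable [MeasurableSpace E] :
    Measurable fun x : ι × (ι → E) => x.2 x.1 :=
  measurable_from_prod_countable_right fun i => measurable_pi_apply i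

theorem aemeasurable_eval_of_countable [MeasurableSpace E] {Y : ι → Ω → E}
    (hκ : AEMeasurable κ P) (hY : ∀ i, AEMeasurable (Y i) P) :
    AEMeasurable (fun ω => Y (κ ω) ω) P :=
  measurable_eval_of_countable.comp_aemeasurable (hκ.prodMk (aemeasurable_pi_lambda _ hY))

variable [NormedAddCommGroup F] [NormedSpace ℝ F] [MeasurableSpace F] [BorelSpace F]
  [SecondCountableTopology F]

theorem integral_eval_of_countable [IsProbabilityMeasure P] {Y : ι → Ω → F} {C : ℝ}
    (hκ : AEMeasurable κ P) (hY : ∀ i, AEMeasurable (Y i) P) (hC : ∀ i ω, ‖Y i ω‖ ≤ C)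
    (hind : IndepFun κ (fun ω i => Y i ω) P) :
    ∫ ω, Y (κ ω) ω ∂P = ∫ ω, ∫ ω', Y (κ ω) ω' ∂P ∂P := by
  have hY' : AEMeasurable (fun ω i => Y i ω) P := aemeasurable_pi_lambda _ hY
  have heval : StronglyMeasurable fun x : ι × (ι → F) => x.2 x.1 :=
    measurable_eval_of_countable.stronglyMeasurable
  have hmap := (indepFun_iff_map_prod_eq_prod_map_map hκ hY').1 hind
  have hint : Integrable (fun x : ι × (ι → F) => x.2 x.1)
      ((P.map κ).prod (P.map fun ω i => Y i ω)) := by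
    rw [← hmap, integrable_map_measure heval.aestronglyMeasurable (hκ.prodMk hY')]
    exact .of_bound (aemeasurable_eval_of_countable hκ hY).aestronglyMeasurable C
      (ae_of_all _ fun ω => hC _ ω)
  calc ∫ ω, Y (κ ω) ω ∂P
      = ∫ x, x.2 x.1 ∂(P.map κ).prod (P.map fun ω i => Y i ω) := by
        rw [← hmap, integral_map (hκ.prodMk hY') heval.aestronglyMeasurable]
    _ = ∫ i, ∫ y, y i ∂(P.map fun ω i => Y i ω) ∂(P.map κ) := integral_prod _ hint
    _ = ∫ i, ∫ ω', Y i ω' ∂P ∂(P.map κ) := by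
        congr 1 with i
        exact integral_map hY' (measurable_pi_apply i).aestronglyMeasurable
    _ = ∫ ω, ∫ ω', Y (κ ω) ω' ∂P ∂P :=
        integral_map hκ Measurable.of_discrete.aestronglyMeasurable

end Countable

variable {e : Ω → ℝ≥0}

theorem aemeasurable_natCeil_mul (he : AEMeasurable e P) (n : ℕ) :
    AEMeasurable (fun ω => ⌈e ω * n⌉₊) P :=
  Nat.measurable_ceil.comp_aemeasurable (he.mul_const _)

theorem tendsto_eval_ceil_mul_div [TopologicalSpace E] {z : ℝ≥0 → E}
    (hz : ∀ t, ContinuousWithinAt z (Set.Ici t) t) (t : ℝ≥0) :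
    Tendsto (fun n : ℕ => z (⌈t * n⌉₊ / n)) atTop (𝓝 (z t)) :=
  (hz t).tendsto.comp (tendsto_ceil_mul_div_nhdsGE t)

theorem aemeasurable_eval_ceil_mul_div [MeasurableSpace E] {X : ℝ≥0 → Ω → E}
    (hX : ∀ t, AEMeasurable (X t) P) (he : AEMeasurable e P) (n : ℕ) :
    AEMeasurable (fun ω => X (⌈e ω * n⌉₊ / n) ω) P :=
  aemeasurable_eval_of_countable (Y := fun k : ℕ => X (k / n)) (aemeasurable_natCeil_mul he n)
    fun _ => hX _

theorem aemeasurable_eval_randomTime [TopologicalSpace E] [TopologicalSpace.PseudoMetrizableSpace E]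
    [MeasurableSpace E] [BorelSpace E] {X : ℝ≥0 → Ω → E} (hX : ∀ t, AEMeasurable (X t) P)
    (hcont : ∀ᵐ ω ∂P, ∀ t, ContinuousWithinAt (fun s => X s ω) (Set.Ici t) t)
    (he : AEMeasurable e P) : AEMeasurable (fun ω => X (e ω) ω) P :=
  aemeasurable_of_tendsto_metrizable_ae atTop (aemeasurable_eval_ceil_mul_div hX he)
    (hcont.mono fun ω hω => tendsto_eval_ceil_mul_div hω (e ω))

section Integral

variable [NormedAddCommGroup F] [NormedSpace ℝ F] [MeasurableSpace F] [BorelSpace F]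
  [SecondCountableTopology F] [IsProbabilityMeasure P] {Z : ℝ≥0 → Ω → F} {C : ℝ}

theorem integral_eval_ceil_mul_div (hZ : ∀ t, AEMeasurable (Z t) P) (hC : ∀ t ω, ‖Z t ω‖ ≤ C)
    (he : AEMeasurable e P) (hind : IndepFun e (fun ω t => Z t ω) P) (n : ℕ) :
    ∫ ω, Z (⌈e ω * n⌉₊ / n) ω ∂P = ∫ ω, ∫ ω', Z (⌈e ω * n⌉₊ / n) ω' ∂P ∂P := by
  have hgrid : IndepFun (fun ω => ⌈e ω * n⌉₊) (fun ω (k : ℕ) => Z (k / n) ω) P :=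
    hind.comp (φ := fun t : ℝ≥0 => ⌈t * n⌉₊) (ψ := fun (z : ℝ≥0 → F) (k : ℕ) => z (k / n))
      (by fun_prop) (by fun_prop)
  exact integral_eval_of_countable (Y := fun k : ℕ => Z (k / n)) (aemeasurable_natCeil_mul he n)
    (fun _ => hZ _) (fun _ => hC _) hgrid

theorem integral_eval_randomTime (hZ : ∀ t, AEMeasurable (Z t) P) (hC : ∀ t ω, ‖Z t ω‖ ≤ C)
    (hcont : ∀ᵐ ω ∂P, ∀ t, ContinuousWithinAt (fun s => Z s ω) (Set.Ici t) t)
    (he : AEMeasurable e P) (hind : IndepFun e (fun ω t => Z t ω) P) :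
    ∫ ω, Z (e ω) ω ∂P = ∫ ω, ∫ ω', Z (e ω) ω' ∂P ∂P := by
  have hjoint : Tendsto (fun n : ℕ => ∫ ω, Z (⌈e ω * n⌉₊ / n) ω ∂P) atTop
      (𝓝 (∫ ω, Z (e ω) ω ∂P)) :=
    tendsto_integral_of_dominated_convergence (fun _ => C)
      (fun n => (aemeasurable_eval_ceil_mul_div hZ he n).aestronglyMeasurable)
      (integrable_const C) (fun n => ae_of_all _ fun ω => hC _ ω)
      (hcont.mono fun ω hω => tendsto_eval_ceil_mul_div hω (e ω))
  have hmean (t : ℝ≥0) : Tendsto (fun n : ℕ => ∫ ω', Z (⌈t * n⌉₊ / n) ω' ∂P) atTop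
      (𝓝 (∫ ω', Z t ω' ∂P)) :=
    tendsto_integral_of_dominated_convergence (fun _ => C)
      (fun n => (hZ _).aestronglyMeasurable) (integrable_const C)
      (fun n => ae_of_all _ fun ω => hC _ ω)
      (hcont.mono fun ω hω => tendsto_eval_ceil_mul_div hω t)
  have hmean_meas (n : ℕ) : AEMeasurable (fun ω => ∫ ω', Z (⌈e ω * n⌉₊ / n) ω' ∂P) P :=
    (Measurable.of_discrete (f := fun k : ℕ => ∫ ω', Z (k / n) ω' ∂P)).comp_aemeasurable
      (aemeasurable_natCeil_mul he n)
  have hmean_bound (t : ℝ≥0) : ‖∫ ω', Z t ω' ∂P‖ ≤ C := by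
    simpa using norm_integral_le_of_norm_le_const (ae_of_all P (hC t))
  have hiterated : Tendsto (fun n : ℕ => ∫ ω, ∫ ω', Z (⌈e ω * n⌉₊ / n) ω' ∂P ∂P) atTop
      (𝓝 (∫ ω, ∫ ω', Z (e ω) ω' ∂P ∂P)) :=
    tendsto_integral_of_dominated_convergence (fun _ => C)
      (fun n => (hmean_meas n).aestronglyMeasurable) (integrable_const C)
      (fun n => ae_of_all _ fun ω => hmean_bound _) (ae_of_all _ fun ω => hmean (e ω))
  exact tendsto_nhds_unique (hjoint.congr (integral_eval_ceil_mul_div hZ hC he hind)) hiterated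

end Integral

theorem charFun_map_eval_randomTime [NormedAddCommGroup E] [InnerProductSpace ℝ E]
    [MeasurableSpace E] [BorelSpace E] [SecondCountableTopology E] [IsProbabilityMeasure P]
    {X : ℝ≥0 → Ω → E} (hX : ∀ t, AEMeasurable (X t) P)
    (hcont : ∀ᵐ ω ∂P, ∀ t, ContinuousWithinAt (fun s => X s ω) (Set.Ici t) t)
    (he : AEMeasurable e P) (hind : IndepFun e (fun ω t => X t ω) P) (θ : E) :
    charFun (P.map fun ω => X (e ω) ω) θ = ∫ ω, charFun (P.map (X (e ω))) θ ∂P := by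
  have hchar : Continuous fun x : E => Complex.exp (inner ℝ x θ * Complex.I) := by fun_prop
  have hmap {Y : Ω → E} (hY : AEMeasurable Y P) :
      charFun (P.map Y) θ = ∫ ω, Complex.exp (inner ℝ (Y ω) θ * Complex.I) ∂P := by
    rw [charFun_apply, integral_map hY hchar.aestronglyMeasurable]
  simp only [hmap (aemeasurable_eval_randomTime hX hcont he), hmap (hX _)]
  exact integral_eval_randomTime (C := 1)
    (fun t => hchar.measurable.comp_aemeasurable (hX t))
    (fun t ω => (Complex.norm_exp_ofReal_mul_I _).le)
    (hcont.mono fun ω hω t => hchar.continuousAt.comp_continuousWithinAt (hω t)) he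
    (hind.comp measurable_id (ψ := fun z : ℝ≥0 → E => fun t =>
      Complex.exp (inner ℝ (z t) θ * Complex.I)) (by fun_prop))

end RandomTime

theorem integral_cexp_mul_expMeasure {q : ℝ} (hq : 0 < q) {Ψ : ℂ} (hΨ : Ψ.re < q) :
    ∫ t : ℝ, Complex.exp (t * Ψ) ∂expMeasure q = q / (q - Ψ) := by
  have hpdf (t : ℝ) : (exponentialPDF q t).toReal • Complex.exp (t * Ψ) =
      (Set.Ici (0 : ℝ)).indicator (fun t : ℝ => q * Complex.exp ((Ψ - q) * t)) t := by
    rw [exponentialPDF_eq, ENNReal.toReal_ofReal (by positivity), Set.indicator_apply]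
    simp only [Set.mem_Ici]
    split_ifs
    · rw [Complex.real_smul, Complex.ofReal_mul, mul_assoc, Complex.ofReal_exp, ← Complex.exp_add]
      congr 2
      push_cast
      ring
    · rw [zero_smul]
  have hdensity : expMeasure q = volume.withDensity (exponentialPDF q) := rfl
  have hmeas : Measurable (exponentialPDF q) := (measurable_exponentialPDFReal q).ennreal_ofReal
  rw [hdensity, integral_withDensity_eq_integral_toReal_smul hmeas
    (ae_of_all _ fun _ => ENNReal.ofReal_lt_top)]
  simp only [hpdf]
  rw [integral_indicator measurableSet_Ici, integral_Ici_eq_integral_Ioi, integral_const_mul,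
    integral_exp_mul_complex_Ioi (by simpa using hΨ), Complex.ofReal_zero, mul_zero,
    Complex.exp_zero, ← neg_sub (q : ℂ), neg_div_neg_eq, mul_one_div]

theorem aemeasurable_of_charFun_ne_zero {Ω E : Type*} [MeasurableSpace Ω] {P : Measure Ω}
    [Inner ℝ E] [MeasurableSpace E] {Y : Ω → E} {t : E} (h : charFun (P.map Y) t ≠ 0) :
    AEMeasurable Y P :=
  .of_map_ne_zero fun h0 => h (by rw [h0, charFun_apply, integral_zero_measure])

namespace HyperexpParams

variable {N N' : ℕ} (p : HyperexpParams N N') {q : ℝ} {Ω : Type*} [MeasurableSpace Ω]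
  {P : Measure Ω} [IsProbabilityMeasure P] {X : ℝ≥0 → Ω → ℝ} {e : Ω → ℝ≥0}

theorem charFun_map_eval_expTime
    (hcont : ∀ᵐ ω ∂P, ∀ t, ContinuousWithinAt (fun s => X s ω) (Set.Ici t) t)
    (hchar : ∀ (t : ℝ≥0) (θ : ℝ),
      charFun (P.map (X t)) θ = Complex.exp ((t : ℝ) * p.levyKhintchine θ))
    (hX : ∀ t, AEMeasurable (X t) P) (he : AEMeasurable e P) (hq : 0 < q)
    (he_law : HasLaw (fun ω => (e ω : ℝ)) (expMeasure q) P)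
    (he_indep : IndepFun e (fun ω t => X t ω) P) (θ : ℝ) :
    charFun (P.map fun ω => X (e ω) ω) θ = q / (q - p.levyKhintchine θ) := by
  rw [charFun_map_eval_randomTime hX hcont he he_indep]
  simp only [hchar]
  rw [← integral_cexp_mul_expMeasure hq ((p.levyKhintchine_re_nonpos θ).trans_lt hq),
    ← he_law.map_eq, integral_map he_law.aemeasurable (by fun_prop)]

theorem hasLaw_killedLaw
    (hcont : ∀ᵐ ω ∂P, ∀ t, ContinuousWithinAt (fun s => X s ω) (Set.Ici t) t)
    (hchar : ∀ (t : ℝ≥0) (θ : ℝ),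
      charFun (P.map (X t)) θ = Complex.exp ((t : ℝ) * p.levyKhintchine θ))
    (hq : 0 < q) (he_law : HasLaw (fun ω => (e ω : ℝ)) (expMeasure q) P)
    (he_indep : IndepFun e (fun ω t => X t ω) P)
    {ζ : Fin p.numPos → ℝ} {ζHat : Fin p.numNeg → ℝ}
    (hζinj : Function.Injective ζ) (hζ : ∀ l, 0 < ζ l ∧ ζ l ∈ p.solutions q)
    (hζHatinj : Function.Injective ζHat) (hζHat : ∀ l, 0 < ζHat l ∧ -ζHat l ∈ p.solutions q) :
    HasLaw (fun ω => X (e ω) ω) (p.killedLaw q ζ ζHat) P := by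
  have hX (t : ℝ≥0) : AEMeasurable (X t) P :=
    aemeasurable_of_charFun_ne_zero (t := 0) (by rw [hchar]; exact Complex.exp_ne_zero _)
  have he : AEMeasurable e P := by simpa using he_law.aemeasurable.real_toNNReal
  have hXe := aemeasurable_eval_randomTime hX hcont he
  have := p.isFiniteMeasure_killedLaw q (fun l => (hζ l).1) fun l => (hζHat l).1
  refine ⟨hXe, Measure.ext_of_charFun ?_⟩
  refine continuous_charFun.ext_on (dense_compl_singleton 0) continuous_charFun fun θ hθ => ?_
  rw [p.charFun_map_eval_expTime hcont hchar hX he hq he_law he_indep,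
    p.charFun_killedLaw hq hζinj hζ hζHatinj hζHat hθ]

end HyperexpParams

end

theorem theorem3p1_general {Ω : Type*} [MeasurableSpace Ω] (P : Measure Ω) [IsProbabilityMeasure P]
    {N N' : ℕ} (p : HyperexpParams N N') (X : ℝ≥0 → Ω → ℝ)
    (hcont : ∀ᵐ ω ∂P, ∀ t, ContinuousWithinAt (fun s => X s ω) (Set.Ici t) t)
    (hchar : ∀ (t : ℝ≥0) (θ : ℝ),
      charFun (P.map (X t)) θ = Complex.exp ((t : ℝ) * p.levyKhintchine θ))
    (q : ℝ) (hq : 0 < q) (e : Ω → ℝ≥0)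
    (he_law : HasLaw (fun ω => (e ω : ℝ)) (expMeasure q) P)
    (he_indep : IndepFun e (fun ω t => X t ω) P) :
    ∃ (ζ : Fin p.numPos → ℝ) (ζHat : Fin p.numNeg → ℝ),
      StrictMono ζ ∧ Set.range ζ = {z | 0 < z ∧ z ∈ p.solutions q} ∧
      StrictMono ζHat ∧ Set.range ζHat = {z | 0 < z ∧ -z ∈ p.solutions q} ∧
      (∀ l, 0 < deriv p.psi (ζ l)) ∧ (∀ l, deriv p.psi (-(ζHat l)) < 0) ∧
      HasLaw (fun ω => X (e ω) ω)
        (ENNReal.ofReal (q * p.alpha q) • Measure.dirac 0 +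
          volume.withDensity (fun x => ENNReal.ofReal (p.killedDensity q ζ ζHat x))) P := by
  obtain ⟨ζ, hζ, hζ_range⟩ := p.exists_positive_solutions hq
  obtain ⟨ζHat, hζHat, hζHat_range⟩ := p.exists_negative_solutions hq
  have hsol (l) : 0 < ζ l ∧ ζ l ∈ p.solutions q := hζ_range.subset (Set.mem_range_self l)
  have hsolHat (l) : 0 < ζHat l ∧ -ζHat l ∈ p.solutions q :=
    hζHat_range.subset (Set.mem_range_self l)
  refine ⟨ζ, ζHat, hζ, hζ_range, hζHat, hζHat_range,
    fun l => p.deriv_psi_pos hq (hsol l).1 (hsol l).2,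
    fun l => p.deriv_psi_neg hq (neg_neg_of_pos (hsolHat l).1) (hsolHat l).2, ?_⟩
  exact p.hasLaw_killedLaw hcont hchar hq he_law he_indep hζ.injective hsol hζHat.injective hsolHat

theorem theorem3p1 {Ω : Type*} [MeasurableSpace Ω] (P : Measure Ω) [IsProbabilityMeasure P]
    {N N' : ℕ} (p : HyperexpParams N N') (X : ℝ≥0 → Ω → ℝ) (hX : IsHyperexponential P X p)
    (q : ℝ) (hq : 0 < q) (e : Ω → ℝ≥0) (he : Measurable e)
    (he_law : HasLaw (fun ω => (e ω : ℝ)) (expMeasure q) P)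
    (he_indep : IndepFun e (fun ω t => X t ω) P) :
    ∃ (ζ : Fin p.numPos → ℝ) (ζHat : Fin p.numNeg → ℝ),
      StrictMono ζ ∧ Set.range ζ = {z | 0 < z ∧ z ∈ p.solutions q} ∧
      StrictMono ζHat ∧ Set.range ζHat = {z | 0 < z ∧ -z ∈ p.solutions q} ∧
      (∀ l, 0 < deriv p.psi (ζ l)) ∧ (∀ l, deriv p.psi (-(ζHat l)) < 0) ∧
      HasLaw (fun ω => X (e ω) ω)
        (ENNReal.ofReal (q * p.alpha q) • Measure.dirac 0 +
          volume.withDensity (fun x => ENNReal.ofReal (p.killedDensity q ζ ζHat x))) P :=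
  theorem3p1_general P p X (hX.cadlag.mono fun _ h t => (h t).1) hX.charFun_eq q hq e he_law
    he_indep
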